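/- **Convergence to the quasi-stationary distribution.** Let $F^*$ be a non-empty, countable, discrete set, let $0\notin F^*$ and $F=F^*\cup\{0\}$. Let $Q_{i,j}\ge 0$ ($i\neq j$ in $F^*$) be jump rates and $p_0:F^*\to[0,\infty)$ a death rate (neither irreducibility nor recurrence of $Q$ is needed), and suppose that Assumption (A) holds: $$\sup_{i\in F^*}\sum_{j\in F^*,\,j\ne i}Q_{i,j}<\infty\qquad\text{and}\qquad \sup_{i\in F^*}p_0(i)<\infty .$$ Let $(P_t)_{t\ge 0}$ be the semigroup on the bounded functions $f:F\to\mathbb R$ generated by the bounded operator $$Gf(i)=p_0(i)\,(f(0)-f(i))+\sum_{j\in F^*}Q_{i,j}\,(f(j)-f(i))\quad(i\in F^*),\qquad Gf(0)=0 .$$ For a probability measure $\mu$ on $F^*$ and $t\ge 0$, let $\mu T_t$ be the law at time $t$, conditioned on non-absorption at $0$ up to time $t$, of the Markov process with generator $G$ and initial law $\mu$; that is, $\mu T_t$ is the probability measure on $F^*$ with $$\mu T_t(\{k\})=\frac{\sum_{y\in F^*}\mu(y)\,P_t\mathbf 1_{\{k\}}(y)}{\sum_{y\in F^*}\mu(y)\,P_t\mathbf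 1_{F^*}(y)}\qquad(k\in F^*).$$ A quasi-stationary distribution is a probability measure $\nu$ on $F^*$ with $\nu T_t=\nu$ for all $t\ge 0$. Put $d_{\mathrm{TV}}(\mu,\nu)=\frac12\sup_{\|f\|_\infty\le 1}\left(\int f\,d\mu-\int f\,d\nu\right)$ and $$\lambda=\inf_{i\ne i'}\Big(Q_{i,i'}+Q_{i',i}+\sum_{j\ne i,i'}\min(Q_{i,j},Q_{i',j})\Big),\qquad \rho=\lambda-\big(\sup p_0-\inf p_0\big),$$ where $\lambda=\rho=+\infty$ if $F^*$ has only one point (with $\infty\cdot 0=0$ and $e^{-\infty}=0$ below). Suppose that $\rho>0$. Then, for all probability measures $\mu,\nu$ on $F^*$ and all $t\ge 0$, $\mu T_t$ is a probability measure and $$d_{\mathrm{TV}}(\mu T_t,\nu T_t)\le e^{-\rho t}\,d_{\mathrm{TV}}(\mu,\nu).$$ Moreover, there is exactly one quasi-stationary distribution $\nu_{\mathrm{qs}}$, and for every probability measure $\mu$ on $F^*$ and all $t\ge 0$, $$d_{\mathrm{TV}}(\mu T_t,\nu_{\mathrm{qs}})\le e^{-\rho t}.$$ -/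

import Mathlib

open MeasureTheory
open scoped NNReal ENNReal

namespace KilledChain

/-! A Markov chain on a countable discrete space `S`, with jump rates `Q i j` (`i ≠ j`), killed at
rate `p i` in the state `i`.  The diagonal entries of `Q` are never used.  The state space with the
absorbing (cemetery) state is `Option S`, the cemetery being `none`. -/

/-- The boundedness assumption: `sup_i ∑_{j ≠ i} Q i j < ∞` and `sup_i p i < ∞`. -/
def BoundedRates {S : Type*} (Q : S → S → ℝ≥0) (p : S → ℝ≥0) : Prop :=
  (⨆ i, ∑' j : {j : S // j ≠ i}, (Q i j : ℝ≥0∞)) < ∞ ∧ (⨆ i, (p i : ℝ≥0∞)) < ∞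

/-- `λ = inf_{i ≠ i'} (Q i i' + Q i' i + ∑_{j ≠ i, i'} min (Q i j) (Q i' j))`, an element of
`[0, ∞]` (equal to `∞` when there is no pair `i ≠ i'`). -/
noncomputable def lam {S : Type*} (Q : S → S → ℝ≥0) : ℝ≥0∞ :=
  ⨅ (i : S) (i' : S) (_ : i ≠ i'),
    ((Q i i' : ℝ≥0∞) + Q i' i + ∑' j : {j : S // j ≠ i ∧ j ≠ i'}, min (Q i j : ℝ≥0∞) (Q i' j))

/-- `ρ = λ - (sup p - inf p)`. -/
noncomputable def rho {S : Type*} (Q : S → S → ℝ≥0) (p : S → ℝ≥0) : EReal :=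
  (lam Q : EReal) -
    (((⨆ i, (p i : ℝ≥0∞) : ℝ≥0∞) : EReal) - ((⨅ i, (p i : ℝ≥0∞) : ℝ≥0∞) : EReal))

/-- The Banach space of bounded functions on `S ∪ {cemetery}`, with the sup norm. -/
abbrev BddFun (S : Type*) : Type _ := lp (fun _ : Option S => ℝ) ∞

/-- `G f (i) = p i (f(0) - f(i)) + ∑_j Q i j (f(j) - f(i))` for `i ∈ S`, and `G f (0) = 0`. -/
noncomputable def genFun {S : Type*} (Q : S → S → ℝ≥0) (p : S → ℝ≥0) (f : Option S → ℝ) :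
    Option S → ℝ
  | none => 0
  | some i => p i * (f none - f (some i)) + ∑' j, (Q i j : ℝ) * (f (some j) - f (some i))

/-- A finite bound for the rates. -/
noncomputable def rateBound {S : Type*} (Q : S → S → ℝ≥0) (p : S → ℝ≥0) : ℝ :=
  (⨆ i, ∑' j : {j : S // j ≠ i}, (Q i j : ℝ≥0∞)).toReal + (⨆ i, (p i : ℝ≥0∞)).toReal

theorem hasSum_bound {S : Type*} {Q : S → S → ℝ≥0} {p : S → ℝ≥0} (hA : BoundedRates Q p) (i : S)
    (C : ℝ) : ∃ s : ℝ, s ≤ (⨆ i, ∑' j : {j : S // j ≠ i}, (Q i j : ℝ≥0∞)).toReal ∧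
      HasSum (Set.indicator {j : S | j ≠ i} (fun j => (Q i j : ℝ) * C)) (s * C) := by
  have hle : ∑' j : {j : S // j ≠ i}, (Q i j : ℝ≥0∞)
      ≤ ⨆ i, ∑' j : {j : S // j ≠ i}, (Q i j : ℝ≥0∞) :=
    le_iSup (fun i => ∑' j : {j : S // j ≠ i}, (Q i j : ℝ≥0∞)) i
  have hlt := hle.trans_lt hA.1
  have hs : Summable (fun j : {j : S // j ≠ i} => (Q i j : ℝ)) :=
    NNReal.summable_coe.2 (ENNReal.tsum_coe_ne_top_iff_summable.1 hlt.ne)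
  refine ⟨∑' j : {j : S // j ≠ i}, (Q i j : ℝ), ?_, ?_⟩
  · refine le_trans (le_of_eq ?_) (ENNReal.toReal_mono hA.1.ne hle)
    rw [ENNReal.tsum_toReal_eq (fun _ => ENNReal.coe_ne_top)]
    rfl
  · exact (hasSum_subtype_iff_indicator (f := fun j => (Q i j : ℝ) * C)
      (s := {j : S | j ≠ i})).1 (hs.hasSum.mul_right C)

theorem norm_term_le {S : Type*} (Q : S → S → ℝ≥0) (f : BddFun S) (i j : S) :
    ‖(Q i j : ℝ) * (f (some j) - f (some i))‖
      ≤ Set.indicator {j : S | j ≠ i} (fun j => (Q i j : ℝ) * (2 * ‖f‖)) j := by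
  by_cases h : j = i
  · subst h; simp
  · rw [Set.indicator_of_mem (show j ∈ {j : S | j ≠ i} from h), norm_mul, NNReal.norm_eq]
    refine mul_le_mul_of_nonneg_left ((norm_sub_le _ _).trans ?_) (Q i j).2
    have h1 := lp.norm_apply_le_norm ENNReal.top_ne_zero f (some i)
    have h2 := lp.norm_apply_le_norm ENNReal.top_ne_zero f (some j)
    linarith

theorem norm_genFun_le {S : Type*} {Q : S → S → ℝ≥0} {p : S → ℝ≥0} (hA : BoundedRates Q p)
    (f : BddFun S) (x : Option S) : ‖genFun Q p f x‖ ≤ 2 * rateBound Q p * ‖f‖ := by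
  cases x with
  | none =>
    have : 0 ≤ rateBound Q p := by unfold rateBound; positivity
    simp only [genFun, norm_zero]
    positivity
  | some i =>
    obtain ⟨s, hs, hsum⟩ := hasSum_bound hA i (2 * ‖f‖)
    have h1 := tsum_of_norm_bounded hsum (norm_term_le Q f i)
    have h2 : (p i : ℝ) ≤ (⨆ i, (p i : ℝ≥0∞)).toReal :=
      ENNReal.toReal_mono hA.2.ne (le_iSup (fun i => (p i : ℝ≥0∞)) i)
    have h3 : ‖f none - f (some i)‖ ≤ 2 * ‖f‖ := by
      have h1 := lp.norm_apply_le_norm ENNReal.top_ne_zero f (some i)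
      have h2 := lp.norm_apply_le_norm ENNReal.top_ne_zero f none
      linarith [norm_sub_le (f none) (f (some i))]
    have h4 : ‖(p i : ℝ) * (f none - f (some i))‖ ≤ (⨆ i, (p i : ℝ≥0∞)).toReal * (2 * ‖f‖) := by
      rw [norm_mul, NNReal.norm_eq]
      exact mul_le_mul h2 h3 (norm_nonneg _) ENNReal.toReal_nonneg
    have h5 := mul_le_mul_of_nonneg_right hs (by positivity : 0 ≤ 2 * ‖f‖)
    simp only [genFun]
    refine (norm_add_le _ _).trans ?_
    unfold rateBound
    linarith

theorem summable_term {S : Type*} {Q : S → S → ℝ≥0} {p : S → ℝ≥0} (hA : BoundedRates Q p)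
    (f : BddFun S) (i : S) : Summable (fun j => (Q i j : ℝ) * (f (some j) - f (some i))) := by
  obtain ⟨s, -, hsum⟩ := hasSum_bound hA i (2 * ‖f‖)
  exact Summable.of_norm_bounded hsum.summable (norm_term_le Q f i)

/-- The generator `G`, a bounded operator on the bounded functions on `S ∪ {cemetery}`. -/
noncomputable def generator {S : Type*} {Q : S → S → ℝ≥0} {p : S → ℝ≥0} (hA : BoundedRates Q p) :
    BddFun S →L[ℝ] BddFun S :=
  LinearMap.mkContinuous
    { toFun := fun f => ⟨genFun Q p f, memℓp_infty
        ⟨2 * rateBound Q p * ‖f‖, by rintro _ ⟨x, rfl⟩; exact norm_genFun_le hA f x⟩⟩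
      map_add' := by
        intro f g
        ext x
        cases x with
        | none => exact (add_zero (0 : ℝ)).symm
        | some i =>
          have h := (summable_term hA f i).tsum_add (summable_term hA g i)
          simp only [genFun, lp.coeFn_add, Pi.add_apply]
          rw [add_add_add_comm, ← h, ← mul_add]
          congr 1
          · ring
          · exact tsum_congr fun j => by ring
      map_smul' := by
        intro c f
        ext x
        cases x with
        | none => simp [genFun]
        | some i =>
          simp only [genFun, lp.coeFn_smul, Pi.smul_apply, smul_eq_mul, RingHom.id_apply]
          rw [mul_add, ← tsum_mul_left]
          congr 1
          · ring
          · exact tsum_congr fun j => by ring }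
    (2 * rateBound Q p)
    (fun f => lp.norm_le_of_forall_le
      ((norm_nonneg _).trans (norm_genFun_le hA f none)) (norm_genFun_le hA f))

/-- The semigroup `P_t = exp (t G)` generated by `G`. -/
noncomputable def semigroup {S : Type*} {Q : S → S → ℝ≥0} {p : S → ℝ≥0} (hA : BoundedRates Q p)
    (t : ℝ) : BddFun S →L[ℝ] BddFun S :=
  NormedSpace.exp (t • generator hA)

/-- The indicator function of a subset of `S ∪ {cemetery}`. -/
noncomputable def ind {S : Type*} (A : Set (Option S)) : BddFun S :=
  ⟨A.indicator 1, memℓp_infty ⟨1, by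
    rintro _ ⟨x, rfl⟩
    by_cases hx : x ∈ A <;> simp [hx]⟩⟩

/-- `μ P_t f`, for a law `μ` on `S`. -/
noncomputable def meanAt {S : Type*} [MeasurableSpace S] {Q : S → S → ℝ≥0} {p : S → ℝ≥0}
    (hA : BoundedRates Q p) (μ : Measure S) (t : ℝ) (f : BddFun S) : ℝ :=
  ∫ y, semigroup hA t f (some y) ∂μ

/-- The law `μ T_t` on `S` at time `t`, conditioned on non-absorption up to time `t`, of the chain
with initial law `μ`: it gives the state `k` the mass `μ P_t 1_{k} / μ P_t 1_S`. -/
noncomputable def condLaw {S : Type*} [MeasurableSpace S] {Q : S → S → ℝ≥0} {p : S → ℝ≥0}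
    (hA : BoundedRates Q p) (μ : Measure S) (t : ℝ) : Measure S :=
  Measure.sum fun k : S =>
    ENNReal.ofReal (meanAt hA μ t (ind {some k}) / meanAt hA μ t (ind {none}ᶜ)) • Measure.dirac k

/-- Quasi-stationary distributions: probability measures `ν` with `ν T_t = ν` for all `t ≥ 0`. -/
def IsQSD {S : Type*} [MeasurableSpace S] {Q : S → S → ℝ≥0} {p : S → ℝ≥0}
    (hA : BoundedRates Q p) (ν : Measure S) : Prop :=
  IsProbabilityMeasure ν ∧ ∀ t : ℝ, 0 ≤ t → condLaw hA ν t = ν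

/-- Total variation distance of two probability measures on a discrete space:
`(1/2) sup_{‖f‖ ≤ 1} (∫ f dμ - ∫ f dν)`. -/
noncomputable def tvDist {S : Type*} [MeasurableSpace S] (μ ν : Measure S) : ℝ≥0∞ :=
  (⨆ (f : S → ℝ) (_ : ∀ x, |f x| ≤ 1), ENNReal.ofReal (∫ x, f x ∂μ - ∫ x, f x ∂ν)) / 2

end KilledChain

/-! The conditioned evolution `μ ↦ μ T_t` is the normalization of the linear killed evolution, and
the normalization may be postponed: normalizing after every step of a scheme, or once at the end,
gives the same law.  So it suffices to show that one normalized step of the Euler scheme `1 + h G`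
contracts the total variation distance by a factor `1 - h ρ + O(h²)`, and to let the step tend to
zero, using that `(1 + (t / n) G) ^ n` converges to `exp (t G)` in norm
(`tendsto_one_add_smul_pow_exp`).

For one step `E = 1 + h G` write `1_S` for the indicator of the non-absorbed states, take `f` with
`0 ≤ f ≤ 1_S`, and let `a = ν E f / ν E 1_S`, a number in `[0, 1]`.  The function
`F = E (f - a 1_S)` satisfies `ν F = 0`, so the normalized means of `f` under `μ E` and `ν E` differ
by `(μ - ν) F / μ E 1_S`.  The oscillation of `F` on `S` is at most `1 - h (λ + inf p)` for small `h`
(`eulerStep_sub_le`), while `μ E 1_S ≥ 1 - h sup p`.  This gives the contraction factor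
`(1 - h (λ + inf p)) / (1 - h sup p)` (`NormalizedDistLE.comp_eulerStep`), whose `n`-th power at
`h = t / n` converges to `exp (-ρ t)` (`NormalizedDistLE.comp_semigroup`).

Laws on `S` are handled as functionals on the bounded functions.  That `μ T_t` has total mass one
needs the countable additivity of `A ↦ μ P_t 1_A`.  It is expressed by continuity under bounded
pointwise convergence (`IsNormal`), a property which the Euler steps have and which passes to
compositions and norm limits.  The same closure property, together with the completeness of the
dual space, turns the contraction into a quasi-stationary distribution
(`exists_isQSD_of_contraction`). -/

open Filter Topology

/-! ### Euler products for the exponential -/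

theorem norm_pow_sub_pow_le_of_le {𝔸 : Type*} [NormedRing 𝔸] {x y : 𝔸} {M : ℝ}
    (h1 : ‖(1 : 𝔸)‖ ≤ 1) (hM : 1 ≤ M) (hx : ‖x‖ ≤ M) (hy : ‖y‖ ≤ M) (n : ℕ) :
    ‖x ^ n - y ^ n‖ ≤ n * ‖x - y‖ * M ^ n := by
  have hpow : ∀ n : ℕ, ‖x ^ n‖ ≤ M ^ n := by
    intro n
    induction n with
    | zero => simpa using h1
    | succ n ih =>
      rw [pow_succ, pow_succ]
      exact (norm_mul_le _ _).trans (mul_le_mul ih hx (norm_nonneg _) (by positivity))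
  induction n with
  | zero => simp
  | succ n ih =>
    have e : x ^ (n + 1) - y ^ (n + 1) = x ^ n * (x - y) + (x ^ n - y ^ n) * y := by
      rw [pow_succ, pow_succ]; noncomm_ring
    have a1 : ‖x ^ n * (x - y)‖ ≤ M ^ n * ‖x - y‖ :=
      (norm_mul_le _ _).trans (mul_le_mul_of_nonneg_right (hpow n) (norm_nonneg _))
    have a2 : ‖(x ^ n - y ^ n) * y‖ ≤ n * ‖x - y‖ * M ^ n * M :=
      (norm_mul_le _ _).trans (mul_le_mul ih hy (norm_nonneg _) (by positivity))
    have a3 : M ^ n * ‖x - y‖ ≤ M ^ n * ‖x - y‖ * M := le_mul_of_one_le_right (by positivity) hM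
    rw [e]
    refine (norm_add_le _ _).trans ?_
    push_cast
    calc _ ≤ M ^ n * ‖x - y‖ * M + n * ‖x - y‖ * M ^ n * M := by linarith
      _ = _ := by ring

/-- The Euler products `(1 + a / n) ^ n` converge to `exp a` in a Banach algebra. -/
theorem tendsto_one_add_smul_pow_exp {𝔸 : Type*} [NormedRing 𝔸] [NormedAlgebra ℝ 𝔸]
    [CompleteSpace 𝔸] (h1 : ‖(1 : 𝔸)‖ ≤ 1) (a : 𝔸) :
    Tendsto (fun n : ℕ => (1 + (n : ℝ)⁻¹ • a) ^ n) atTop (𝓝 (NormedSpace.exp a)) := by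
  let : NormedAlgebra ℚ 𝔸 := NormedAlgebra.restrictScalars ℚ ℝ 𝔸
  have hinv : Tendsto (fun n : ℕ => (n : ℝ)⁻¹ • a) atTop (𝓝 0) := by
    simpa using (tendsto_inv_atTop_nhds_zero_nat (𝕜 := ℝ)).smul_const a
  have ho := (hasFDerivAt_iff_isLittleO_nhds_zero.1
    (hasFDerivAt_exp_zero (𝕂 := ℝ) (𝔸 := 𝔸))).comp_tendsto hinv
  rw [tendsto_iff_norm_sub_tendsto_zero]
  rw [Metric.tendsto_atTop]
  intro ε hε
  have hK : 0 < (‖a‖ + 1) * Real.exp (2 * ‖a‖) := by positivity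
  set δ : ℝ := min 1 (ε / ((‖a‖ + 1) * Real.exp (2 * ‖a‖))) with hδ
  have hδ0 : 0 < δ := lt_min one_pos (div_pos hε hK)
  obtain ⟨N, hN⟩ := eventually_atTop.1 ((Asymptotics.isLittleO_iff.1 ho) hδ0)
  refine ⟨N + 1, fun n hn => ?_⟩
  have hn0 : (0 : ℝ) < n := by exact_mod_cast (by omega : 0 < n)
  have hb := hN n (by omega)
  simp only [Function.comp, zero_add, NormedSpace.exp_zero, one_apply_eq_self,
    norm_smul, norm_inv, RCLike.norm_natCast] at hb
  have hy : NormedSpace.exp ((n : ℝ)⁻¹ • a) ^ n = NormedSpace.exp a := by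
    rw [← NormedSpace.exp_nsmul, ← Nat.cast_smul_eq_nsmul ℝ, smul_smul, mul_inv_cancel₀ hn0.ne',
      one_smul]
  set y := NormedSpace.exp ((n : ℝ)⁻¹ • a)
  set c : ℝ := (n : ℝ)⁻¹ * ‖a‖ with hc
  have hc0 : 0 ≤ c := by positivity
  have hx : ‖1 + (n : ℝ)⁻¹ • a‖ ≤ 1 + c := by
    refine (norm_add_le _ _).trans (add_le_add h1 ?_)
    rw [norm_smul, norm_inv, RCLike.norm_natCast]
  have hxy : ‖(1 + (n : ℝ)⁻¹ • a) - y‖ ≤ δ * c := by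
    rw [norm_sub_rev, ← sub_sub]; exact hb
  have hdc : δ * c ≤ c := mul_le_of_le_one_left hc0 (min_le_left _ _)
  have hyn : ‖y‖ ≤ 1 + 2 * c := by
    have := norm_sub_norm_le y (1 + (n : ℝ)⁻¹ • a)
    rw [norm_sub_rev] at this
    linarith
  have hmain := norm_pow_sub_pow_le_of_le h1 (by linarith) (hx.trans (by linarith)) hyn n
  rw [hy] at hmain
  have hexp : (1 + 2 * c) ^ n ≤ Real.exp (2 * ‖a‖) := by
    have h := pow_le_pow_left₀ (by linarith)
      ((add_comm _ _).trans_le (Real.add_one_le_exp (2 * c))) n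
    rw [← Real.exp_nat_mul] at h
    refine h.trans_eq ?_
    congr 1
    rw [hc]; field_simp
  rw [Real.dist_eq, sub_zero, abs_norm]
  refine hmain.trans_lt ?_
  calc _ ≤ n * (δ * c) * Real.exp (2 * ‖a‖) := by gcongr
    _ = δ * (‖a‖ * Real.exp (2 * ‖a‖)) := by rw [hc]; field_simp
    _ < δ * ((‖a‖ + 1) * Real.exp (2 * ‖a‖)) := by
        have := Real.exp_pos (2 * ‖a‖)
        gcongr; linarith
    _ ≤ ε / ((‖a‖ + 1) * Real.exp (2 * ‖a‖)) * ((‖a‖ + 1) * Real.exp (2 * ‖a‖)) := by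
        gcongr; exact min_le_right _ _
    _ = ε := by field_simp

theorem exp_add_smul {𝔸 : Type*} [NormedRing 𝔸] [NormedAlgebra ℝ 𝔸] [CompleteSpace 𝔸]
    (s t : ℝ) (a : 𝔸) :
    NormedSpace.exp ((s + t) • a) = NormedSpace.exp (s • a) * NormedSpace.exp (t • a) := by
  let : NormedAlgebra ℚ 𝔸 := NormedAlgebra.restrictScalars ℚ ℝ 𝔸
  rw [add_smul]
  exact NormedSpace.exp_add_of_commute (((Commute.refl a).smul_left s).smul_right t)

namespace KilledChain

/-! ### Rates and overlaps of rates -/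

section Rates
variable {S : Type*} {Q : S → S → ℝ≥0} {p : S → ℝ≥0}

theorem rateBound_nonneg (Q : S → S → ℝ≥0) (p : S → ℝ≥0) : 0 ≤ rateBound Q p := by
  unfold rateBound; positivity

theorem BoundedRates.killing_le (hA : BoundedRates Q p) (i : S) :
    (p i : ℝ) ≤ (⨆ i, (p i : ℝ≥0∞)).toReal :=
  ENNReal.toReal_mono hA.2.ne (le_iSup (fun i => (p i : ℝ≥0∞)) i)

theorem BoundedRates.killing_le_rateBound (hA : BoundedRates Q p) (i : S) :
    (p i : ℝ) ≤ rateBound Q p := by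
  have := hA.killing_le i
  have : (0 : ℝ) ≤ (⨆ i, ∑' j : {j : S // j ≠ i}, (Q i j : ℝ≥0∞)).toReal := ENNReal.toReal_nonneg
  unfold rateBound; linarith

/-- The off-diagonal part of the rate matrix, with zero diagonal. -/
noncomputable def offDiag (Q : S → S → ℝ≥0) (i : S) : S → ℝ :=
  Set.indicator {j : S | j ≠ i} (fun j => (Q i j : ℝ))

theorem offDiag_nonneg (Q : S → S → ℝ≥0) (i j : S) : 0 ≤ offDiag Q i j :=
  Set.indicator_nonneg (fun _ _ => NNReal.coe_nonneg _) _

theorem offDiag_of_ne (Q : S → S → ℝ≥0) {i j : S} (h : j ≠ i) : offDiag Q i j = Q i j :=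
  Set.indicator_of_mem (s := {j : S | j ≠ i}) h _

theorem BoundedRates.summable_offDiag (hA : BoundedRates Q p) (i : S) :
    Summable (offDiag Q i) := by
  obtain ⟨s, -, h⟩ := hasSum_bound hA i 1
  simpa [offDiag] using h.summable

theorem BoundedRates.tsum_offDiag_le (hA : BoundedRates Q p) (i : S) :
    ∑' j, offDiag Q i j ≤ (⨆ i, ∑' j : {j : S // j ≠ i}, (Q i j : ℝ≥0∞)).toReal := by
  obtain ⟨s, hs, h⟩ := hasSum_bound hA i 1
  simp only [mul_one] at h
  exact h.tsum_eq.trans_le hs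

theorem BoundedRates.tsum_offDiag_add_killing_le (hA : BoundedRates Q p) (i : S) :
    ∑' j, offDiag Q i j + p i ≤ rateBound Q p :=
  add_le_add (hA.tsum_offDiag_le i) (hA.killing_le i)

/-- The `j`-th summand of the rate at which the best coupling of two copies of the chain started at
`i ≠ k` makes them meet: a jump onto the other copy, or a common jump to a third state. -/
noncomputable def overlap (Q : S → S → ℝ≥0) (i k j : S) : ℝ≥0 :=
  open Classical in if j = k then Q i k else if j = i then Q k i else min (Q i j) (Q k j)

theorem overlap_le (Q : S → S → ℝ≥0) {i k : S} (hik : i ≠ k) (j : S) :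
    (overlap Q i k j : ℝ) ≤ offDiag Q i j + offDiag Q k j := by
  have h1 := offDiag_nonneg Q i j
  have h2 := offDiag_nonneg Q k j
  unfold overlap
  split_ifs with hk hi
  · subst hk; rw [offDiag_of_ne Q hik.symm] at *; linarith
  · subst hi; rw [offDiag_of_ne Q hik] at *; linarith
  · rw [offDiag_of_ne Q hi] at *
    rw [NNReal.coe_min]
    exact (min_le_left _ _).trans (by linarith)

theorem BoundedRates.summable_overlap (hA : BoundedRates Q p) {i k : S} (hik : i ≠ k) :
    Summable fun j => (overlap Q i k j : ℝ) :=
  Summable.of_nonneg_of_le (fun _ => NNReal.coe_nonneg _) (overlap_le Q hik)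
    ((hA.summable_offDiag i).add (hA.summable_offDiag k))

theorem lam_le_tsum_overlap (Q : S → S → ℝ≥0) {i k : S} (hik : i ≠ k) :
    lam Q ≤ ∑' j, (overlap Q i k j : ℝ≥0∞) := by
  classical
  refine (iInf_le_of_le i (iInf_le_of_le k (iInf_le _ hik))).trans (le_of_eq ?_)
  have h1 : (Q i k : ℝ≥0∞) = ∑' j, if j = k then (Q i k : ℝ≥0∞) else 0 :=
    (tsum_ite_eq k fun _ => (Q i k : ℝ≥0∞)).symm
  have h2 : (Q k i : ℝ≥0∞) = ∑' j, if j = i then (Q k i : ℝ≥0∞) else 0 :=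
    (tsum_ite_eq i fun _ => (Q k i : ℝ≥0∞)).symm
  have h3 : ∑' j : {j : S // j ≠ i ∧ j ≠ k}, min (Q i j : ℝ≥0∞) (Q k j) =
      ∑' j, {j : S | j ≠ i ∧ j ≠ k}.indicator (fun j => min (Q i j : ℝ≥0∞) (Q k j)) j :=
    tsum_subtype {j : S | j ≠ i ∧ j ≠ k} fun j => min (Q i j : ℝ≥0∞) (Q k j)
  rw [h3, h1, h2, ← ENNReal.tsum_add, ← ENNReal.tsum_add]
  refine tsum_congr fun j => ?_
  unfold overlap
  by_cases hk : j = k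
  · subst hk; simp [hik.symm]
  · by_cases hi : j = i
    · subst hi; simp [hik]
    · simp [hk, hi, Set.indicator]

theorem BoundedRates.le_tsum_overlap (hA : BoundedRates Q p) {l : ℝ}
    (hl : ENNReal.ofReal l ≤ lam Q) {i k : S} (hik : i ≠ k) :
    l ≤ ∑' j, (overlap Q i k j : ℝ) := by
  have h := hl.trans (lam_le_tsum_overlap Q hik)
  have e : ∑' j, (overlap Q i k j : ℝ≥0∞) = ENNReal.ofReal (∑' j, (overlap Q i k j : ℝ)) := by
    rw [ENNReal.ofReal_tsum_of_nonneg (fun _ => NNReal.coe_nonneg _) (hA.summable_overlap hik)]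
    exact tsum_congr fun j => (ENNReal.ofReal_coe_nnreal).symm
  rw [e] at h
  exact (ENNReal.ofReal_le_ofReal_iff (tsum_nonneg fun _ => NNReal.coe_nonneg _)).1 h

theorem lam_ne_top [Nontrivial S] (hA : BoundedRates Q p) : lam Q ≠ ∞ := by
  obtain ⟨i, k, hik⟩ := exists_pair_ne S
  refine ((lam_le_tsum_overlap Q hik).trans_lt ?_).ne
  exact (ENNReal.tsum_coe_ne_top_iff_summable.2
    (NNReal.summable_coe.1 (hA.summable_overlap hik))).lt_top

theorem rho_eq_coe [Nontrivial S] (hA : BoundedRates Q p) :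
    rho Q p = (((lam Q).toReal -
      ((⨆ i, (p i : ℝ≥0∞)).toReal - (⨅ i, (p i : ℝ≥0∞)).toReal) : ℝ) : EReal) := by
  have hinf : (⨅ i, (p i : ℝ≥0∞)) ≠ ∞ :=
    ((iInf_le _ (Classical.arbitrary S)).trans_lt ENNReal.coe_lt_top).ne
  rw [rho, EReal.coe_sub, EReal.coe_sub, EReal.coe_ennreal_toReal (lam_ne_top hA),
    EReal.coe_ennreal_toReal hA.2.ne, EReal.coe_ennreal_toReal hinf]

end Rates

/-! ### The Euler step and its oscillation estimate -/

section Euler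
variable {S : Type*} {Q : S → S → ℝ≥0} {p : S → ℝ≥0}

/-- The indicator function of the set of non-absorbed states. -/
noncomputable abbrev alive (S : Type*) : BddFun S := ind {none}ᶜ

@[simp] theorem alive_none : alive S none = 0 := by simp [alive, ind]

@[simp] theorem alive_some (i : S) : alive S (some i) = 1 := by simp [alive, ind]

/-- One step of the Euler scheme for the semigroup. -/
noncomputable def eulerStep (hA : BoundedRates Q p) (h : ℝ) : BddFun S →L[ℝ] BddFun S :=
  1 + h • generator hA

@[simp] theorem eulerStep_none (hA : BoundedRates Q p) (h : ℝ) (f : BddFun S) :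
    eulerStep hA h f none = f none := by
  change f none + h * 0 = f none
  ring

theorem eulerStep_some (hA : BoundedRates Q p) (h : ℝ) (f : BddFun S) (i : S) :
    eulerStep hA h f (some i) = f (some i) + h * (p i * (f none - f (some i)) +
      ∑' j, (Q i j : ℝ) * (f (some j) - f (some i))) := rfl

theorem mul_sub_eq_offDiag (Q : S → S → ℝ≥0) (f : BddFun S) (i j : S) :
    (Q i j : ℝ) * (f (some j) - f (some i)) = offDiag Q i j * (f (some j) - f (some i)) := by
  by_cases hj : j = i
  · subst hj; simp
  · rw [offDiag_of_ne Q hj]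

theorem eulerStep_nonneg (hA : BoundedRates Q p) {h : ℝ} (h0 : 0 ≤ h)
    (hh : h * rateBound Q p ≤ 1) {f : BddFun S} (hf0 : f none = 0) (hf : ∀ x, 0 ≤ f x)
    (x : Option S) : 0 ≤ eulerStep hA h f x := by
  cases x with
  | none => rw [eulerStep_none]; exact hf _
  | some i =>
    have h1 : (∑' j, offDiag Q i j) * -f (some i) ≤
        ∑' j, (Q i j : ℝ) * (f (some j) - f (some i)) := by
      rw [← tsum_mul_right]
      refine Summable.tsum_le_tsum (fun j => ?_) ((hA.summable_offDiag i).mul_right _)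
        (summable_term hA f i)
      rw [mul_sub_eq_offDiag]
      exact mul_le_mul_of_nonneg_left (by linarith [hf (some j)]) (offDiag_nonneg Q i j)
    have h2 := mul_le_mul_of_nonneg_left (hA.tsum_offDiag_add_killing_le i) h0
    rw [eulerStep_some, hf0]
    have h3 := mul_le_mul_of_nonneg_left h1 h0
    have h4 := mul_nonneg (sub_nonneg.2 (h2.trans hh)) (hf (some i))
    linarith

theorem eulerStep_alive (hA : BoundedRates Q p) (h : ℝ) (i : S) :
    eulerStep hA h (alive S) (some i) = 1 - h * p i := by
  simp only [eulerStep_some, alive_some, alive_none]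
  simp; ring

/-- The oscillation estimate behind the contraction: one Euler step, recentred by `a ∈ [0, 1]`,
maps functions with values in `[0, 1]` to functions of oscillation at most `1 - h (l + b)`, for
`l ≤ λ` and `b ≤ inf p`.  The extreme case `f i = 1`, `f k = 0` gives the bound; the slack
`1 - (f i - f k)` absorbs all the other terms because `h` is small. -/
theorem eulerStep_sub_le (hA : BoundedRates Q p) {h : ℝ} (h0 : 0 ≤ h)
    (hh : 4 * (h * rateBound Q p) ≤ 1) {l b : ℝ} (hl : ENNReal.ofReal l ≤ lam Q)
    (hb : ∀ i, b ≤ p i) {f : BddFun S} (hf0 : f none = 0) (hf : ∀ x, 0 ≤ f x)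
    (hf1 : ∀ x, f x ≤ 1) {a : ℝ} (ha0 : 0 ≤ a) (ha1 : a ≤ 1) {i k : S} (hik : i ≠ k) :
    eulerStep hA h (f - a • alive S) (some i) - eulerStep hA h (f - a • alive S) (some k)
      ≤ 1 - h * (l + b) := by
  set s : ℝ := 1 - f (some i) + f (some k) with hs
  have hu : 0 ≤ 1 - f (some i) := sub_nonneg.2 (hf1 _)
  have hv : 0 ≤ f (some k) := hf _
  have hs0 : 0 ≤ s := by linarith
  have hT : ∀ j, (Q i j : ℝ) * (f (some j) - f (some i)) - Q k j * (f (some j) - f (some k))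
      ≤ (offDiag Q i j + offDiag Q k j) * s - overlap Q i k j := by
    intro j
    have n1 := offDiag_nonneg Q i j
    have n2 := offDiag_nonneg Q k j
    rw [mul_sub_eq_offDiag, mul_sub_eq_offDiag]
    unfold overlap
    split_ifs with hk hi
    · subst hk
      rw [← offDiag_of_ne Q hik.symm, sub_self, mul_zero]
      have := mul_nonneg n2 hs0
      rw [hs] at *
      linarith
    · subst hi
      rw [← offDiag_of_ne Q hik, sub_self, mul_zero]
      have := mul_nonneg n1 hs0
      rw [hs] at *
      linarith
    · rw [NNReal.coe_min, ← offDiag_of_ne Q hi, ← offDiag_of_ne Q hk]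
      have m1 := mul_nonneg n1 hv
      have m2 := mul_nonneg n2 hu
      have w0 := hf (some j)
      have w1 := hf1 (some j)
      rw [hs]
      rcases min_cases (offDiag Q i j) (offDiag Q k j) with ⟨e, hle⟩ | ⟨e, hlt⟩ <;> rw [e]
      · have := mul_nonneg (sub_nonneg.2 hle) w0
        linarith
      · have := mul_nonneg (sub_nonneg.2 hlt.le) (sub_nonneg.2 w1)
        linarith
  have hsum := Summable.tsum_le_tsum hT ((summable_term hA f i).sub (summable_term hA f k))
    ((((hA.summable_offDiag i).add (hA.summable_offDiag k)).mul_right s).sub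
      (hA.summable_overlap hik))
  rw [(summable_term hA f i).tsum_sub (summable_term hA f k),
    (((hA.summable_offDiag i).add (hA.summable_offDiag k)).mul_right s).tsum_sub
      (hA.summable_overlap hik), tsum_mul_right,
    (hA.summable_offDiag i).tsum_add (hA.summable_offDiag k)] at hsum
  have hlam := hA.le_tsum_overlap hl hik
  have hqi := hA.tsum_offDiag_add_killing_le i
  have hqk := hA.tsum_offDiag_add_killing_le k
  rw [map_sub, map_smul]
  simp only [lp.coeFn_sub, lp.coeFn_smul, Pi.sub_apply, Pi.smul_apply, smul_eq_mul,
    eulerStep_alive]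
  rw [eulerStep_some, eulerStep_some, hf0]
  set qi := ∑' j, offDiag Q i j
  set qk := ∑' j, offDiag Q k j
  set Ti := ∑' j, (Q i j : ℝ) * (f (some j) - f (some i))
  set Tk := ∑' j, (Q k j : ℝ) * (f (some j) - f (some k))
  have e1 : Ti - Tk ≤ (qi + qk) * s - l := by linarith
  have pi0 := (p i).2
  have pk0 := (p k).2
  have e2 : -(p i * (f (some i) - a)) + p k * (f (some k) - a) ≤ (p i + p k) * s - b := by
    have := mul_nonneg pi0 hv
    have := mul_nonneg pk0 hu
    have := mul_nonneg (sub_nonneg.2 ha1) (sub_nonneg.2 (hb i))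
    have := mul_nonneg ha0 (sub_nonneg.2 (hb k))
    rw [hs]
    simp only [NNReal.val_eq_coe] at *
    linarith
  have e3 : (qi + qk) * s + (p i + p k) * s ≤ 2 * rateBound Q p * s := by
    rw [← add_mul]
    exact mul_le_mul_of_nonneg_right (by linarith) hs0
  have e4 : h * ((Ti - Tk) + (-(p i * (f (some i) - a)) + p k * (f (some k) - a)))
      ≤ h * (2 * rateBound Q p * s - l - b) := mul_le_mul_of_nonneg_left (by linarith) h0
  have e5 : 4 * (h * rateBound Q p) * s ≤ 1 * s := mul_le_mul_of_nonneg_right hh hs0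
  have e6 : f (some i) - f (some k) = 1 - s := by rw [hs]; ring
  linarith

end Euler

/-! ### Contraction by the normalized Euler scheme -/

section Contraction
variable {S : Type*} {Q : S → S → ℝ≥0} {p : S → ℝ≥0}

theorem bddFun_sub_smul_apply (f g : BddFun S) (a : ℝ) (x : Option S) :
    (f - a • g) x = f x - a * g x := rfl

theorem bddFun_smul_apply (a : ℝ) (f : BddFun S) (x : Option S) : (a • f) x = a * f x := rfl

theorem abs_apply_le_norm (f : BddFun S) (x : Option S) : |f x| ≤ ‖f‖ :=
  lp.norm_apply_le_norm ENNReal.top_ne_zero f x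

theorem exists_bddFun_eq {g : S → ℝ} {C : ℝ} (hg : ∀ x, |g x| ≤ C) :
    ∃ f : BddFun S, f none = 0 ∧ ∀ i, f (some i) = g i := by
  refine ⟨⟨fun x => x.elim 0 g, memℓp_infty ⟨max C 0, ?_⟩⟩, rfl, fun _ => rfl⟩
  rintro _ ⟨x, rfl⟩
  cases x with
  | none => simp
  | some i => exact (hg i).trans (le_max_left _ _)

theorem ind_singleton_none (k : S) : (ind {some k} : BddFun S) none = 0 := by simp [ind]

theorem ind_nonneg (A : Set (Option S)) (x : Option S) : 0 ≤ (ind A : BddFun S) x :=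
  Set.indicator_nonneg (fun _ _ => zero_le_one) x

/-- Positivity of a functional on the functions that vanish at the cemetery. -/
def IsPositive (φ : BddFun S →L[ℝ] ℝ) : Prop :=
  ∀ f : BddFun S, f none = 0 → (∀ x, 0 ≤ f x) → 0 ≤ φ f

/-- The normalized functionals `φ / φ (1_S)` and `ψ / ψ (1_S)` are at total variation distance at
most `d`, tested against the functions on `S` with values in `[0, 1]`. -/
def NormalizedDistLE (φ ψ : BddFun S →L[ℝ] ℝ) (d : ℝ) : Prop :=
  ∀ f : BddFun S, f none = 0 → (∀ x, 0 ≤ f x) → (∀ x, f x ≤ 1) →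
    φ f / φ (alive S) - ψ f / ψ (alive S) ≤ d

theorem NormalizedDistLE.nonneg {φ ψ : BddFun S →L[ℝ] ℝ} {d : ℝ} (h : NormalizedDistLE φ ψ d) :
    0 ≤ d := by
  simpa using h 0 rfl (fun _ => le_rfl) (fun _ => zero_le_one)

theorem IsPositive.mono {φ : BddFun S →L[ℝ] ℝ} (hφ : IsPositive φ) {f g : BddFun S}
    (h0 : f none = g none) (h : ∀ i, f (some i) ≤ g (some i)) : φ f ≤ φ g := by
  have := hφ (g - f) (by simp [h0]) (fun x => by
    cases x with
    | none => simp [h0]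
    | some i => simpa using h i)
  rwa [map_sub, sub_nonneg] at this

/-- Two normalized functionals at distance at most `d` differ by at most `c * d` on a function of
oscillation at most `c`. -/
theorem NormalizedDistLE.sub_le_of_oscillation [Nonempty S] {φ ψ : BddFun S →L[ℝ] ℝ} {d : ℝ}
    (h : NormalizedDistLE φ ψ d) (hφ : 0 < φ (alive S)) (hψ : 0 < ψ (alive S)) {c : ℝ} (hc : 0 < c)
    {F : BddFun S} (hF0 : F none = 0) (hF : ∀ i k, F (some i) - F (some k) ≤ c) :
    φ F / φ (alive S) - ψ F / ψ (alive S) ≤ c * d := by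
  have hbdd : BddBelow (Set.range fun i : S => F (some i)) := by
    refine ⟨-‖F‖, ?_⟩
    rintro _ ⟨i, rfl⟩
    exact neg_le_of_abs_le (lp.norm_apply_le_norm ENNReal.top_ne_zero F (some i))
  set m : ℝ := ⨅ i : S, F (some i) with hm
  have hm1 : ∀ i, m ≤ F (some i) := fun i => ciInf_le hbdd i
  have hm2 : ∀ i, F (some i) - m ≤ c := fun i => by
    have : F (some i) - c ≤ m := le_ciInf fun k => by linarith [hF i k]
    linarith
  have e0 : (F - m • alive S) none = 0 := by
    rw [bddFun_sub_smul_apply, hF0, alive_none, mul_zero, sub_zero]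
  have e1 : ∀ i, (F - m • alive S) (some i) = F (some i) - m := fun i => by
    rw [bddFun_sub_smul_apply, alive_some, mul_one]
  have key := h (c⁻¹ • (F - m • alive S)) (by rw [bddFun_smul_apply, e0, mul_zero])
    (fun x => by
      rw [bddFun_smul_apply]
      cases x with
      | none => rw [e0, mul_zero]
      | some i => rw [e1]; exact mul_nonneg (inv_nonneg.2 hc.le) (sub_nonneg.2 (hm1 i)))
    (fun x => by
      rw [bddFun_smul_apply]
      cases x with
      | none => rw [e0, mul_zero]; exact zero_le_one
      | some i => rw [e1, ← div_eq_inv_mul]; exact (div_le_one hc).2 (hm2 i))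
  simp only [map_smul, map_sub, smul_eq_mul] at key
  have e : φ F / φ (alive S) - ψ F / ψ (alive S) =
      c * (c⁻¹ * (φ F - m * φ (alive S)) / φ (alive S) -
        c⁻¹ * (ψ F - m * ψ (alive S)) / ψ (alive S)) := by
    field_simp
    ring
  rw [e]
  exact mul_le_mul_of_nonneg_left key hc.le

theorem IsPositive.comp_eulerStep {φ : BddFun S →L[ℝ] ℝ} (hφ : IsPositive φ)
    (hA : BoundedRates Q p) {h : ℝ} (h0 : 0 ≤ h) (hh : h * rateBound Q p ≤ 1) :
    IsPositive (φ.comp (eulerStep hA h)) := fun f hf0 hf =>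
  hφ _ ((eulerStep_none hA h f).trans hf0) (eulerStep_nonneg hA h0 hh hf0 hf)

theorem IsPositive.mul_le_eulerStep_alive {φ : BddFun S →L[ℝ] ℝ} (hφ : IsPositive φ)
    (hA : BoundedRates Q p) {h : ℝ} (h0 : 0 ≤ h) {B : ℝ} (hB : ∀ i, (p i : ℝ) ≤ B) :
    (1 - h * B) * φ (alive S) ≤ φ (eulerStep hA h (alive S)) := by
  rw [← smul_eq_mul, ← map_smul]
  refine hφ.mono (by rw [bddFun_smul_apply, eulerStep_none, alive_none, mul_zero]) fun i => ?_
  rw [eulerStep_alive, bddFun_smul_apply, alive_some]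
  linarith [mul_le_mul_of_nonneg_left (hB i) h0]

/-- One normalized Euler step contracts the total variation distance. -/
theorem NormalizedDistLE.comp_eulerStep [Nonempty S] {φ ψ : BddFun S →L[ℝ] ℝ} {d : ℝ}
    (h : NormalizedDistLE φ ψ d) (hφ : IsPositive φ) (hψ : IsPositive ψ) (hφ1 : 0 < φ (alive S))
    (hψ1 : 0 < ψ (alive S)) (hA : BoundedRates Q p) {η : ℝ} (h0 : 0 ≤ η)
    (hh : 4 * (η * rateBound Q p) ≤ 1) {l b B : ℝ} (hl : ENNReal.ofReal l ≤ lam Q)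
    (hb : ∀ i, b ≤ p i) (hB : ∀ i, (p i : ℝ) ≤ B) (hB1 : η * B < 1) (hlb : η * (l + b) < 1) :
    NormalizedDistLE (φ.comp (eulerStep hA η)) (ψ.comp (eulerStep hA η))
      ((1 - η * (l + b)) / (1 - η * B) * d) := by
  intro f hf0 hf hf1
  have hr := mul_nonneg h0 (rateBound_nonneg Q p)
  have hEφ := hφ.mul_le_eulerStep_alive hA h0 hB
  have hEψ := hψ.mul_le_eulerStep_alive hA h0 hB
  have hB1' : 0 < 1 - η * B := sub_pos.2 hB1
  have hEφ0 : 0 < φ (eulerStep hA η (alive S)) := (mul_pos hB1' hφ1).trans_le hEφ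
  have hEψ0 : 0 < ψ (eulerStep hA η (alive S)) := (mul_pos hB1' hψ1).trans_le hEψ
  have hψE := hψ.comp_eulerStep hA h0 (by linarith)
  simp only [ContinuousLinearMap.comp_apply]
  -- Recentring `f` by its second mean makes the second mean of the image `F` vanish.
  set a := ψ (eulerStep hA η f) / ψ (eulerStep hA η (alive S)) with ha
  have ha0 : 0 ≤ a := div_nonneg (hψE f hf0 hf) hEψ0.le
  have ha1 : a ≤ 1 := (div_le_one hEψ0).2
    (hψE.mono (by simp [hf0]) fun i => by simpa using hf1 (some i))
  have hosc := h.sub_le_of_oscillation hφ1 hψ1 (sub_pos.2 hlb)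
    (F := eulerStep hA η (f - a • alive S))
    (by rw [eulerStep_none, bddFun_sub_smul_apply, hf0, alive_none, mul_zero, sub_zero])
    (fun i k => by
      by_cases hik : i = k
      · subst hik; rw [sub_self]; exact (sub_pos.2 hlb).le
      · exact eulerStep_sub_le hA h0 hh hl hb hf0 hf hf1 ha0 ha1 hik)
  have eψ : ψ (eulerStep hA η (f - a • alive S)) = 0 := by
    rw [map_sub, map_sub, map_smul, map_smul, smul_eq_mul, ha, div_mul_cancel₀ _ hEψ0.ne', sub_self]
  rw [eψ, zero_div, sub_zero, div_le_iff₀ hφ1, map_sub, map_sub, map_smul, map_smul,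
    smul_eq_mul] at hosc
  have hd := h.nonneg
  have e : φ (eulerStep hA η f) / φ (eulerStep hA η (alive S)) - a =
      (φ (eulerStep hA η f) - a * φ (eulerStep hA η (alive S))) /
        φ (eulerStep hA η (alive S)) := by
    field_simp
  rw [e, div_le_iff₀ hEφ0]
  refine hosc.trans ?_
  have h2 : 0 ≤ (1 - η * (l + b)) * d / (1 - η * B) :=
    div_nonneg (mul_nonneg (sub_pos.2 hlb).le hd) hB1'.le
  have h3 := mul_le_mul_of_nonneg_left hEφ h2
  calc _ = (1 - η * (l + b)) * d / (1 - η * B) * ((1 - η * B) * φ (alive S)) := by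
        field_simp
    _ ≤ _ := h3
    _ = _ := by ring

theorem IsPositive.comp_eulerStep_pow {φ : BddFun S →L[ℝ] ℝ} (hφ : IsPositive φ)
    (hA : BoundedRates Q p) {h : ℝ} (h0 : 0 ≤ h) (hh : h * rateBound Q p ≤ 1) (n : ℕ) :
    IsPositive (φ.comp (eulerStep hA h ^ n)) := by
  induction n with
  | zero => exact hφ
  | succ n ih => rw [pow_succ]; exact ih.comp_eulerStep hA h0 hh

theorem IsPositive.pow_mul_le_eulerStep_pow_alive {φ : BddFun S →L[ℝ] ℝ} (hφ : IsPositive φ)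
    (hA : BoundedRates Q p) {h : ℝ} (h0 : 0 ≤ h) (hh : h * rateBound Q p ≤ 1) {B : ℝ}
    (hB : ∀ i, (p i : ℝ) ≤ B) (hB1 : h * B < 1) (n : ℕ) :
    (1 - h * B) ^ n * φ (alive S) ≤ φ ((eulerStep hA h ^ n) (alive S)) := by
  induction n with
  | zero => simp
  | succ n ih =>
    have h1 := (hφ.comp_eulerStep_pow hA h0 hh n).mul_le_eulerStep_alive hA h0 hB
    have h2 := mul_le_mul_of_nonneg_left ih (sub_pos.2 hB1).le
    rw [pow_succ (eulerStep hA h)]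
    refine le_trans (le_of_eq ?_) (h2.trans h1)
    ring

theorem NormalizedDistLE.comp_eulerStep_pow [Nonempty S] {φ ψ : BddFun S →L[ℝ] ℝ} {d : ℝ}
    (h : NormalizedDistLE φ ψ d) (hφ : IsPositive φ) (hψ : IsPositive ψ) (hφ1 : 0 < φ (alive S))
    (hψ1 : 0 < ψ (alive S)) (hA : BoundedRates Q p) {η : ℝ} (h0 : 0 ≤ η)
    (hh : 4 * (η * rateBound Q p) ≤ 1) {l b B : ℝ} (hl : ENNReal.ofReal l ≤ lam Q)
    (hb : ∀ i, b ≤ p i) (hB : ∀ i, (p i : ℝ) ≤ B) (hB1 : η * B < 1) (hlb : η * (l + b) < 1)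
    (n : ℕ) :
    NormalizedDistLE (φ.comp (eulerStep hA η ^ n)) (ψ.comp (eulerStep hA η ^ n))
      (((1 - η * (l + b)) / (1 - η * B)) ^ n * d) := by
  have hh' : η * rateBound Q p ≤ 1 := by
    linarith [mul_nonneg h0 (rateBound_nonneg Q p)]
  induction n with
  | zero => rw [pow_zero, pow_zero, one_mul]; exact h
  | succ n ih =>
    have hpos : 0 < (1 - η * B) ^ n := pow_pos (sub_pos.2 hB1) n
    rw [pow_succ (eulerStep hA η), pow_succ', mul_assoc]
    exact ih.comp_eulerStep (hφ.comp_eulerStep_pow hA h0 hh' n)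
      (hψ.comp_eulerStep_pow hA h0 hh' n)
      ((mul_pos hpos hφ1).trans_le (hφ.pow_mul_le_eulerStep_pow_alive hA h0 hh' hB hB1 n))
      ((mul_pos hpos hψ1).trans_le (hψ.pow_mul_le_eulerStep_pow_alive hA h0 hh' hB hB1 n))
      hA h0 hh hl hb hB hB1 hlb

end Contraction

/-! ### Passage to the semigroup -/

section Semigroup
variable {S : Type*} {Q : S → S → ℝ≥0} {p : S → ℝ≥0}

theorem tendsto_eulerStep_pow (hA : BoundedRates Q p) (t : ℝ) :
    Tendsto (fun n : ℕ => eulerStep hA (t / n) ^ n) atTop (𝓝 (semigroup hA t)) := by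
  have h := tendsto_one_add_smul_pow_exp (ContinuousLinearMap.norm_id_le (𝕜 := ℝ) (E := BddFun S))
    (t • generator hA)
  refine h.congr fun n => ?_
  rw [smul_smul, eulerStep, div_eq_inv_mul]

theorem tendsto_comp_eulerStep_pow (hA : BoundedRates Q p) (φ : BddFun S →L[ℝ] ℝ) (t : ℝ) :
    Tendsto (fun n : ℕ => φ.comp (eulerStep hA (t / n) ^ n)) atTop
      (𝓝 (φ.comp (semigroup hA t))) :=
  ((continuous_const.clm_comp continuous_id).tendsto (semigroup hA t)).comp
    (tendsto_eulerStep_pow hA t)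

theorem tendsto_apply_eulerStep_pow (hA : BoundedRates Q p) (φ : BddFun S →L[ℝ] ℝ) (t : ℝ)
    (f : BddFun S) :
    Tendsto (fun n : ℕ => φ ((eulerStep hA (t / n) ^ n) f)) atTop (𝓝 (φ (semigroup hA t f))) :=
  ((ContinuousLinearMap.apply ℝ ℝ f).continuous.tendsto _).comp
    (tendsto_comp_eulerStep_pow hA φ t)

theorem eventually_div_mul_lt (t c : ℝ) {ε : ℝ} (hε : 0 < ε) :
    ∀ᶠ n : ℕ in atTop, t / n * c < ε := by
  have h := (tendsto_const_div_atTop_nhds_zero_nat t).mul_const c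
  rw [zero_mul] at h
  exact h.eventually_lt_const hε

/-- The evaluation at a point of `S ∪ {cemetery}`. -/
noncomputable def evalAt (x : Option S) : BddFun S →L[ℝ] ℝ :=
  lp.evalCLM ℝ (fun _ : Option S => ℝ) ∞ x

@[simp] theorem evalAt_apply (x : Option S) (f : BddFun S) : evalAt x f = f x := rfl

/-- The cemetery is absorbing. -/
theorem semigroup_none (hA : BoundedRates Q p) (t : ℝ) (f : BddFun S) :
    semigroup hA t f none = f none := by
  have h := tendsto_apply_eulerStep_pow hA (evalAt none) t f
  refine tendsto_nhds_unique h (tendsto_const_nhds.congr fun n => ?_)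
  generalize t / (n : ℝ) = η
  rw [evalAt_apply]
  induction n generalizing f with
  | zero => simp
  | succ n ih =>
    rw [pow_succ]
    change _ = (eulerStep hA η ^ n) (eulerStep hA η f) none
    rw [← ih _ (tendsto_apply_eulerStep_pow hA _ t _), eulerStep_none]

theorem IsPositive.comp_semigroup {φ : BddFun S →L[ℝ] ℝ} (hφ : IsPositive φ)
    (hA : BoundedRates Q p) {t : ℝ} (ht : 0 ≤ t) : IsPositive (φ.comp (semigroup hA t)) := by
  intro f hf0 hf
  refine ge_of_tendsto (tendsto_apply_eulerStep_pow hA φ t f) ?_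
  filter_upwards [eventually_div_mul_lt t (rateBound Q p) one_pos] with n hn
  exact hφ.comp_eulerStep_pow hA (by positivity) hn.le n f hf0 hf

theorem tendsto_one_sub_div_mul_pow (t c : ℝ) :
    Tendsto (fun n : ℕ => (1 - t / n * c) ^ n) atTop (𝓝 (Real.exp (-(c * t)))) := by
  refine (Real.tendsto_one_add_div_pow_exp (-(c * t))).congr fun n => ?_
  congr 1
  ring

theorem IsPositive.semigroup_alive_pos {φ : BddFun S →L[ℝ] ℝ} (hφ : IsPositive φ)
    (hφ1 : 0 < φ (alive S)) (hA : BoundedRates Q p) {t : ℝ} (ht : 0 ≤ t) :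
    0 < φ (semigroup hA t (alive S)) := by
  refine (mul_pos (Real.exp_pos (-(rateBound Q p * t))) hφ1).trans_le ?_
  refine le_of_tendsto_of_tendsto ((tendsto_one_sub_div_mul_pow t _).mul_const _)
    (tendsto_apply_eulerStep_pow hA φ t _) ?_
  filter_upwards [eventually_div_mul_lt t (rateBound Q p) one_pos] with n hn
  exact hφ.pow_mul_le_eulerStep_pow_alive hA (by positivity) hn.le hA.killing_le_rateBound hn n

/-- The normalized semigroup contracts the total variation distance at rate `l - (B - b)`, for
`l ≤ λ`, `b ≤ inf p` and `sup p ≤ B`. -/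
theorem NormalizedDistLE.comp_semigroup [Nonempty S] {φ ψ : BddFun S →L[ℝ] ℝ} {d : ℝ}
    (h : NormalizedDistLE φ ψ d) (hφ : IsPositive φ) (hψ : IsPositive ψ) (hφ1 : 0 < φ (alive S))
    (hψ1 : 0 < ψ (alive S)) (hA : BoundedRates Q p) {t : ℝ} (ht : 0 ≤ t)
    {l b B : ℝ} (hl : ENNReal.ofReal l ≤ lam Q) (hb : ∀ i, b ≤ p i) (hB : ∀ i, (p i : ℝ) ≤ B) :
    NormalizedDistLE (φ.comp (semigroup hA t)) (ψ.comp (semigroup hA t))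
      (Real.exp (-((l - (B - b)) * t)) * d) := by
  intro f hf0 hf hf1
  have lim1 := ((tendsto_apply_eulerStep_pow hA φ t f).div
    (tendsto_apply_eulerStep_pow hA φ t (alive S)) (hφ.semigroup_alive_pos hφ1 hA ht).ne').sub
    ((tendsto_apply_eulerStep_pow hA ψ t f).div
      (tendsto_apply_eulerStep_pow hA ψ t (alive S)) (hψ.semigroup_alive_pos hψ1 hA ht).ne')
  have lim2 := (((tendsto_one_sub_div_mul_pow t (l + b)).div (tendsto_one_sub_div_mul_pow t B)
    (Real.exp_pos _).ne').mul_const d)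
  have e : Real.exp (-((l + b) * t)) / Real.exp (-(B * t)) = Real.exp (-((l - (B - b)) * t)) := by
    rw [← Real.exp_sub]; congr 1; ring
  rw [e] at lim2
  refine le_of_tendsto_of_tendsto lim1 lim2 ?_
  filter_upwards [eventually_div_mul_lt t (rateBound Q p) (by norm_num : (0 : ℝ) < 1 / 4),
    eventually_div_mul_lt t B one_pos, eventually_div_mul_lt t (l + b) one_pos] with n h1 h2 h3
  have := h.comp_eulerStep_pow hφ hψ hφ1 hψ1 hA (by positivity : 0 ≤ t / (n : ℝ)) (by linarith)
    hl hb hB h2 h3 n f hf0 hf hf1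
  rw [div_pow] at this
  exact this

theorem semigroup_add (hA : BoundedRates Q p) (s t : ℝ) (f : BddFun S) :
    semigroup hA (s + t) f = semigroup hA s (semigroup hA t f) := by
  have : semigroup hA (s + t) = semigroup hA s * semigroup hA t := exp_add_smul s t (generator hA)
  rw [this]
  rfl

end Semigroup

/-! ### Normal functionals -/

section Normal
variable {S : Type*} {Q : S → S → ℝ≥0} {p : S → ℝ≥0}

/-- Normality of a functional, the analogue of countable additivity: continuity along bounded
pointwise convergent families.  Families indexed by the finite subsets of `S` suffice, since they
are the partial sums of series over `S`. -/
def IsNormal (φ : BddFun S →L[ℝ] ℝ) : Prop :=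
  ∀ (u : Finset S → BddFun S) (f : BddFun S) (C : ℝ), (∀ s, ‖u s‖ ≤ C) →
    (∀ x, Tendsto (fun s => u s x) atTop (𝓝 (f x))) → Tendsto (fun s => φ (u s)) atTop (𝓝 (φ f))

theorem IsNormal.of_tendsto {φ : BddFun S →L[ℝ] ℝ} {ψ : ℕ → BddFun S →L[ℝ] ℝ}
    (hψ : ∀ n, IsNormal (ψ n)) (h : Tendsto ψ atTop (𝓝 φ)) : IsNormal φ := by
  intro u f C hu hf
  have hC : 0 ≤ C := (norm_nonneg _).trans (hu ∅)
  rw [Metric.tendsto_nhds]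
  intro ε hε
  have hK : 0 < C + ‖f‖ + 1 := by positivity
  have hδ : 0 < ε / 2 / (C + ‖f‖ + 1) := by positivity
  obtain ⟨n, hn⟩ := (Metric.tendsto_nhds.1 h _ hδ).exists
  rw [dist_comm, dist_eq_norm] at hn
  filter_upwards [Metric.tendsto_nhds.1 (hψ n u f C hu hf) _ (half_pos hε)] with s hs
  rw [dist_eq_norm] at *
  have e : φ (u s) - φ f = (φ - ψ n) (u s - f) + (ψ n (u s) - ψ n f) := by
    simp only [sub_apply, map_sub]; ring
  have h1 : ‖(φ - ψ n) (u s - f)‖ ≤ ε / 2 / (C + ‖f‖ + 1) * (C + ‖f‖) := by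
    refine (ContinuousLinearMap.le_opNorm _ _).trans ?_
    exact mul_le_mul hn.le ((norm_sub_le _ _).trans (by linarith [hu s])) (norm_nonneg _) hδ.le
  have h2 : ε / 2 / (C + ‖f‖ + 1) * (C + ‖f‖) ≤ ε / 2 := by
    rw [div_mul_eq_mul_div, div_le_iff₀ hK]
    exact mul_le_mul_of_nonneg_left (by linarith) (by positivity)
  rw [e]
  exact (norm_add_le _ _).trans_lt (by linarith)

theorem isNormal_eulerStep (hA : BoundedRates Q p) (η : ℝ) (x : Option S) :
    IsNormal ((evalAt x).comp (eulerStep hA η)) := by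
  intro u f C hu hf
  simp only [ContinuousLinearMap.comp_apply, evalAt_apply]
  cases x with
  | none => simpa using hf none
  | some i =>
    simp only [eulerStep_some]
    obtain ⟨s, -, hs⟩ := hasSum_bound hA i (2 * C)
    have hsub : ∀ x y, Tendsto (fun v => u v x - u v y) atTop (𝓝 (f x - f y)) :=
      fun x y => Tendsto.sub (G := ℝ) (hf x) (hf y)
    refine Tendsto.add (M := ℝ) (hf _) (((hsub _ _).const_mul _).add ?_ |>.const_mul _)
    refine tendsto_tsum_of_dominated_convergence hs.summable
      (fun j => (hsub _ _).const_mul _) (Eventually.of_forall fun v j => ?_)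
    refine (norm_term_le Q (u v) i j).trans (Set.indicator_le_indicator ?_)
    exact mul_le_mul_of_nonneg_left (by linarith [hu v]) (Q i j).2

theorem IsNormal.comp {φ : BddFun S →L[ℝ] ℝ} (hφ : IsNormal φ) {T : BddFun S →L[ℝ] BddFun S}
    (hT : ∀ x, IsNormal ((evalAt x).comp T)) : IsNormal (φ.comp T) := by
  intro u f C hu hf
  refine hφ (fun s => T (u s)) (T f) (‖T‖ * C) (fun s => ?_) (fun x => hT x u f C hu hf)
  exact (T.le_opNorm _).trans (mul_le_mul_of_nonneg_left (hu s) (norm_nonneg _))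

theorem IsNormal.comp_semigroup {φ : BddFun S →L[ℝ] ℝ} (hφ : IsNormal φ) (hA : BoundedRates Q p)
    (t : ℝ) : IsNormal (φ.comp (semigroup hA t)) := by
  refine .of_tendsto (fun n => ?_) (tendsto_comp_eulerStep_pow hA φ t)
  generalize t / (n : ℝ) = η
  induction n with
  | zero => exact hφ
  | succ n ih =>
    rw [pow_succ]
    exact ih.comp (isNormal_eulerStep hA η)

/-- A normal functional is a series over its values on the indicators of the points of `S`. -/
theorem IsNormal.hasSum {φ : BddFun S →L[ℝ] ℝ} (hφ : IsNormal φ) {f : BddFun S}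
    (hf : f none = 0) : HasSum (fun k : S => f (some k) * φ (ind {some k})) (φ f) := by
  classical
  set u : Finset S → BddFun S := fun s => ∑ k ∈ s, f (some k) • ind {some k} with hu
  have hux : ∀ s x, u s x = ∑ k ∈ s, f (some k) * (ind {some k} : BddFun S) x := fun s x => by
    rw [← evalAt_apply, hu, map_sum]
    rfl
  have hnone : ∀ s, u s none = 0 := fun s => by
    rw [hux]
    exact Finset.sum_eq_zero fun k _ => by simp [ind]
  have hsome : ∀ s i, u s (some i) = if i ∈ s then f (some i) else 0 := fun s i => by
    rw [hux]
    simp [ind, Pi.single_apply]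
  have h := hφ u f ‖f‖ (fun s => ?_) (fun x => ?_)
  · simpa [hu, HasSum] using h
  · refine lp.norm_le_of_forall_le (norm_nonneg _) fun x => ?_
    cases x with
    | none => rw [hnone, norm_zero]; exact norm_nonneg _
    | some i =>
      rw [hsome]
      split_ifs
      · exact lp.norm_apply_le_norm ENNReal.top_ne_zero f _
      · rw [norm_zero]; exact norm_nonneg _
  · cases x with
    | none => simp only [hnone, hf]; exact tendsto_const_nhds
    | some i =>
      refine tendsto_const_nhds.congr' ?_
      filter_upwards [eventually_ge_atTop {i}] with s hs
      rw [hsome, if_pos (Finset.singleton_subset_iff.1 hs)]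

end Normal

/-! ### Laws on `S` as functionals -/

section Measures
variable {S : Type*} [MeasurableSpace S]

/-- The measure on `S` given by the normalization of a functional through its values on the
indicators of points; a probability measure for positive normal functionals. -/
noncomputable def stateMeasure (φ : BddFun S →L[ℝ] ℝ) : Measure S :=
  Measure.sum fun k : S => ENNReal.ofReal (φ (ind {some k}) / φ (alive S)) • Measure.dirac k

theorem isProbabilityMeasure_stateMeasure {φ : BddFun S →L[ℝ] ℝ} (hφ : IsPositive φ)
    (hn : IsNormal φ) (h1 : 0 < φ (alive S)) : IsProbabilityMeasure (stateMeasure φ) := by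
  constructor
  have hs : HasSum (fun k : S => φ (ind {some k}) / φ (alive S)) 1 := by
    have := (hn.hasSum (f := alive S) alive_none).div_const (φ (alive S))
    simpa [div_self h1.ne'] using this
  rw [stateMeasure, Measure.sum_apply _ MeasurableSet.univ]
  simp only [Measure.smul_apply, measure_univ, smul_eq_mul, mul_one]
  rw [← ENNReal.ofReal_tsum_of_nonneg (fun k =>
    div_nonneg (hφ _ (ind_singleton_none k) (ind_nonneg _)) h1.le) hs.summable, hs.tsum_eq,
    ENNReal.ofReal_one]

variable [DiscreteMeasurableSpace S]

theorem integrable_of_abs_le (μ : Measure S) [IsFiniteMeasure μ] {g : S → ℝ} {C : ℝ}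
    (hg : ∀ x, |g x| ≤ C) : Integrable g μ :=
  .of_bound (Measurable.of_discrete).aestronglyMeasurable C (Eventually.of_forall hg)

theorem integrable_bddFun (μ : Measure S) [IsFiniteMeasure μ] (f : BddFun S) :
    Integrable (fun y => f (some y)) μ :=
  integrable_of_abs_le μ fun y => abs_apply_le_norm f (some y)

/-- The integral against a law on `S`, as a functional on `BddFun S`. -/
noncomputable def meanFunctional (μ : Measure S) [IsProbabilityMeasure μ] : BddFun S →L[ℝ] ℝ :=
  LinearMap.mkContinuous
    { toFun := fun f => ∫ y, f (some y) ∂μ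
      map_add' := fun f g => integral_add (integrable_bddFun μ f) (integrable_bddFun μ g)
      map_smul' := fun c f => integral_const_mul c fun y => f (some y) }
    1 (fun f => by
      have := norm_integral_le_of_norm_le_const (μ := μ) (f := fun y => f (some y)) (C := ‖f‖)
        (Eventually.of_forall fun y => abs_apply_le_norm f (some y))
      rw [probReal_univ, mul_one] at this
      rw [one_mul]
      exact this)

theorem meanFunctional_apply (μ : Measure S) [IsProbabilityMeasure μ] (f : BddFun S) :
    meanFunctional μ f = ∫ y, f (some y) ∂μ := rfl

theorem isPositive_meanFunctional (μ : Measure S) [IsProbabilityMeasure μ] :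
    IsPositive (meanFunctional μ) := fun _ _ hf => integral_nonneg fun y => hf (some y)

theorem meanFunctional_alive (μ : Measure S) [IsProbabilityMeasure μ] :
    meanFunctional μ (alive S) = 1 := by
  simp [meanFunctional_apply]

theorem isNormal_meanFunctional [Countable S] (μ : Measure S) [IsProbabilityMeasure μ] :
    IsNormal (meanFunctional μ) := fun _ _ C hu hf =>
  tendsto_integral_filter_of_dominated_convergence (fun _ => C)
    (Eventually.of_forall fun _ => (Measurable.of_discrete).aestronglyMeasurable)
    (Eventually.of_forall fun s => Eventually.of_forall fun _ =>
      (abs_apply_le_norm _ _).trans (hu s))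
    (integrable_const C) (Eventually.of_forall fun y => hf (some y))

theorem integral_stateMeasure {φ : BddFun S →L[ℝ] ℝ} (hφ : IsPositive φ)
    (hn : IsNormal φ) (h1 : 0 < φ (alive S)) {f : BddFun S} (hf : f none = 0) :
    ∫ y, f (some y) ∂(stateMeasure φ) = φ f / φ (alive S) := by
  have := isProbabilityMeasure_stateMeasure hφ hn h1
  have h := hasSum_integral_measure (integrable_bddFun (stateMeasure φ) f)
  refine h.unique (((hn.hasSum hf).div_const (φ (alive S))).congr_fun fun k => ?_)
  rw [integral_smul_measure, integral_dirac, ENNReal.toReal_ofReal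
    (div_nonneg (hφ _ (ind_singleton_none k) (ind_nonneg _)) h1.le), smul_eq_mul]
  ring

end Measures

/-! ### Total variation distance -/

section TotalVariation
variable {S : Type*} [MeasurableSpace S]

theorem tvDist_self (μ : Measure S) : tvDist μ μ = 0 := by simp [tvDist]

theorem integral_sub_le_of_tvDist_le {μ ν : Measure S} {d : ℝ} (hd : 0 ≤ d)
    (h : tvDist μ ν ≤ ENNReal.ofReal d) {g : S → ℝ} (hg : ∀ x, |g x| ≤ 1) :
    ∫ x, g x ∂μ - ∫ x, g x ∂ν ≤ 2 * d := by
  have h1 : ENNReal.ofReal (∫ x, g x ∂μ - ∫ x, g x ∂ν) ≤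
      ⨆ (f : S → ℝ) (_ : ∀ x, |f x| ≤ 1), ENNReal.ofReal (∫ x, f x ∂μ - ∫ x, f x ∂ν) :=
    le_iSup₂ (f := fun (f : S → ℝ) (_ : ∀ x, |f x| ≤ 1) =>
      ENNReal.ofReal (∫ x, f x ∂μ - ∫ x, f x ∂ν)) g hg
  have h2 := ENNReal.div_le_iff_le_mul (Or.inl two_ne_zero) (Or.inl ENNReal.ofNat_ne_top) |>.1 h
  have h3 := h1.trans h2
  have e2 : (2 : ℝ≥0∞) = ENNReal.ofReal 2 := by simp
  rw [e2, mul_comm, ← ENNReal.ofReal_mul (by norm_num)] at h3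
  exact (ENNReal.ofReal_le_ofReal_iff (by positivity)).1 h3

variable [DiscreteMeasurableSpace S]

theorem tvDist_le_of_forall {μ ν : Measure S} [IsProbabilityMeasure μ] [IsProbabilityMeasure ν]
    {d : ℝ} (h : ∀ f : BddFun S, f none = 0 → (∀ x, 0 ≤ f x) → (∀ x, f x ≤ 1) →
      meanFunctional μ f - meanFunctional ν f ≤ d) : tvDist μ ν ≤ ENNReal.ofReal d := by
  rw [tvDist]
  refine ENNReal.div_le_of_le_mul (iSup₂_le fun g hg => ?_)
  have e2 : (2 : ℝ≥0∞) = ENNReal.ofReal 2 := by simp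
  rw [e2, mul_comm, ← ENNReal.ofReal_mul (by norm_num)]
  refine ENNReal.ofReal_le_ofReal ?_
  have hg' : ∀ x, 0 ≤ (g x + 1) / 2 ∧ (g x + 1) / 2 ≤ 1 := fun x => by
    have := abs_le.1 (hg x)
    constructor <;> linarith
  obtain ⟨f, hf0, hf⟩ := exists_bddFun_eq (g := fun x => (g x + 1) / 2) (C := 1)
    (fun x => abs_le.2 ⟨by linarith [(hg' x).1], (hg' x).2⟩)
  have key := h f hf0
    (fun x => by
      cases x with
      | none => rw [hf0]
      | some i => rw [hf]; exact (hg' i).1)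
    (fun x => by
      cases x with
      | none => rw [hf0]; exact zero_le_one
      | some i => rw [hf]; exact (hg' i).2)
  have e : ∀ (m : Measure S) [IsProbabilityMeasure m],
      meanFunctional m f = (∫ x, g x ∂m + 1) / 2 := fun m _ => by
    rw [meanFunctional_apply]
    simp only [hf]
    rw [integral_div, integral_add (integrable_of_abs_le m hg) (integrable_const _)]
    simp
  rw [e, e] at key
  linarith

theorem meanFunctional_sub_le_of_tvDist_le {μ ν : Measure S} [IsProbabilityMeasure μ]
    [IsProbabilityMeasure ν] {d : ℝ} (hd : 0 ≤ d) (h : tvDist μ ν ≤ ENNReal.ofReal d)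
    {f : BddFun S} (hf : ∀ x, 0 ≤ f x) (hf1 : ∀ x, f x ≤ 1) :
    meanFunctional μ f - meanFunctional ν f ≤ d := by
  have key := integral_sub_le_of_tvDist_le hd h (g := fun x => 2 * f (some x) - 1) (fun x =>
    abs_le.2 ⟨by linarith [hf (some x)], by linarith [hf1 (some x)]⟩)
  have e : ∀ (m : Measure S) [IsProbabilityMeasure m],
      ∫ x, (2 * f (some x) - 1) ∂m = 2 * meanFunctional m f - 1 := fun m _ => by
    rw [integral_sub ((integrable_bddFun m f).const_mul 2) (integrable_const _),
      integral_const_mul, meanFunctional_apply]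
    simp
  rw [e, e] at key
  linarith

theorem abs_meanFunctional_sub_le {μ ν : Measure S} [IsProbabilityMeasure μ]
    [IsProbabilityMeasure ν] {d : ℝ} (hd : 0 ≤ d) (h : tvDist μ ν ≤ ENNReal.ofReal d)
    (f : BddFun S) : |meanFunctional μ f - meanFunctional ν f| ≤ 2 * d * ‖f‖ := by
  have one_side : ∀ f : BddFun S, meanFunctional μ f - meanFunctional ν f ≤ 2 * d * ‖f‖ := by
    intro f
    rcases eq_or_ne f 0 with rfl | hf
    · simp
    have hn : 0 < ‖f‖ := norm_pos_iff.2 hf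
    have key := integral_sub_le_of_tvDist_le hd h (g := fun x => f (some x) / ‖f‖) (fun x => by
      rw [abs_div, abs_norm]
      exact (div_le_one hn).2 (abs_apply_le_norm f _))
    rw [integral_div, integral_div, ← sub_div, div_le_iff₀ hn] at key
    exact key
  rw [abs_le]
  have := one_side (-f)
  rw [map_neg, map_neg, norm_neg] at this
  exact ⟨by linarith, one_side f⟩

theorem tvDist_le_one (μ ν : Measure S) [IsProbabilityMeasure μ] [IsProbabilityMeasure ν] :
    tvDist μ ν ≤ 1 := by
  rw [← ENNReal.ofReal_one]
  refine tvDist_le_of_forall fun f hf0 hf hf1 => ?_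
  have h1 : meanFunctional μ f ≤ meanFunctional μ (alive S) :=
    (isPositive_meanFunctional μ).mono (by rw [hf0, alive_none]) fun i => by
      rw [alive_some]; exact hf1 _
  have h2 := isPositive_meanFunctional ν f hf0 hf
  rw [meanFunctional_alive] at h1
  linarith

theorem eq_of_tvDist_eq_zero [Countable S] {μ ν : Measure S} [IsProbabilityMeasure μ]
    [IsProbabilityMeasure ν] (h : tvDist μ ν = 0) : μ = ν := by
  refine Measure.ext_of_singleton fun k => ?_
  have h0 : tvDist μ ν ≤ ENNReal.ofReal 0 := by simp [h]
  have := abs_meanFunctional_sub_le le_rfl h0 (ind {some k})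
  have e : ∀ (m : Measure S) [IsProbabilityMeasure m],
      meanFunctional m (ind {some k}) = m.real {k} := fun m _ => by
    rw [meanFunctional_apply, ← integral_indicator_one (measurableSet_singleton k)]
    refine integral_congr_ae (Eventually.of_forall fun y => ?_)
    by_cases hy : y = k <;> simp [ind, hy]
  rw [mul_zero, zero_mul, abs_nonpos_iff, sub_eq_zero, e, e] at this
  exact (measureReal_eq_measureReal_iff).1 this

end TotalVariation

/-! ### The conditioned evolution -/

section ConditionedLaw
variable {S : Type*} [MeasurableSpace S] [DiscreteMeasurableSpace S]
  {Q : S → S → ℝ≥0} {p : S → ℝ≥0}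

theorem condLaw_eq_stateMeasure (hA : BoundedRates Q p) (μ : Measure S) [IsProbabilityMeasure μ]
    (t : ℝ) : condLaw hA μ t = stateMeasure ((meanFunctional μ).comp (semigroup hA t)) := rfl

theorem meanFunctional_semigroup_alive_pos (hA : BoundedRates Q p) (μ : Measure S)
    [IsProbabilityMeasure μ] {t : ℝ} (ht : 0 ≤ t) :
    0 < meanFunctional μ (semigroup hA t (alive S)) :=
  (isPositive_meanFunctional μ).semigroup_alive_pos
    ((meanFunctional_alive μ).symm ▸ one_pos) hA ht

theorem isProbabilityMeasure_condLaw [Countable S] (hA : BoundedRates Q p) (μ : Measure S)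
    [IsProbabilityMeasure μ] {t : ℝ} (ht : 0 ≤ t) : IsProbabilityMeasure (condLaw hA μ t) := by
  have h := meanFunctional_semigroup_alive_pos hA μ ht
  rw [← ContinuousLinearMap.comp_apply] at h
  rw [condLaw_eq_stateMeasure]
  exact isProbabilityMeasure_stateMeasure ((isPositive_meanFunctional μ).comp_semigroup hA ht)
    ((isNormal_meanFunctional μ).comp_semigroup hA t) h

theorem integral_condLaw [Countable S] (hA : BoundedRates Q p) (μ : Measure S)
    [IsProbabilityMeasure μ] {t : ℝ} (ht : 0 ≤ t) {f : BddFun S} (hf : f none = 0) :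
    ∫ y, f (some y) ∂(condLaw hA μ t) =
      meanFunctional μ (semigroup hA t f) / meanFunctional μ (semigroup hA t (alive S)) := by
  have h := meanFunctional_semigroup_alive_pos hA μ ht
  rw [← ContinuousLinearMap.comp_apply] at h
  rw [condLaw_eq_stateMeasure, integral_stateMeasure
    ((isPositive_meanFunctional μ).comp_semigroup hA ht)
    ((isNormal_meanFunctional μ).comp_semigroup hA t) h hf]
  rfl

/-- The conditioned evolution is a (nonlinear) semigroup. -/
theorem condLaw_condLaw [Countable S] (hA : BoundedRates Q p) (μ : Measure S)
    [IsProbabilityMeasure μ] {s : ℝ} (hs : 0 ≤ s) (t : ℝ) :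
    condLaw hA (condLaw hA μ s) t = condLaw hA μ (s + t) := by
  have hZ := (meanFunctional_semigroup_alive_pos hA μ hs).ne'
  have e : ∀ f : BddFun S, f none = 0 → meanAt hA (condLaw hA μ s) t f =
      meanAt hA μ (s + t) f / meanFunctional μ (semigroup hA s (alive S)) := fun f hf => by
    unfold meanAt
    rw [integral_condLaw hA μ hs ((semigroup_none hA t f).trans hf), semigroup_add]
    rfl
  unfold condLaw at e ⊢
  congr 1
  funext k
  rw [e _ (ind_singleton_none k), e _ alive_none, div_div_div_cancel_right₀ hZ]

theorem tvDist_condLaw_le [Countable S] [Nonempty S] (hA : BoundedRates Q p) (μ ν : Measure S)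
    [IsProbabilityMeasure μ] [IsProbabilityMeasure ν] {t : ℝ} (ht : 0 ≤ t) {l b B : ℝ}
    (hl : ENNReal.ofReal l ≤ lam Q) (hb : ∀ i, b ≤ p i) (hB : ∀ i, (p i : ℝ) ≤ B) :
    tvDist (condLaw hA μ t) (condLaw hA ν t)
      ≤ ENNReal.ofReal (Real.exp (-((l - (B - b)) * t))) * tvDist μ ν := by
  have := isProbabilityMeasure_condLaw hA μ ht
  have := isProbabilityMeasure_condLaw hA ν ht
  have hfin : tvDist μ ν ≠ ∞ := ((tvDist_le_one μ ν).trans_lt ENNReal.one_lt_top).ne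
  have hle : tvDist μ ν ≤ ENNReal.ofReal (tvDist μ ν).toReal := (ENNReal.ofReal_toReal hfin).ge
  have h1 := meanFunctional_alive μ
  have h2 := meanFunctional_alive ν
  have h : NormalizedDistLE (meanFunctional μ) (meanFunctional ν) (tvDist μ ν).toReal :=
    fun f _ hf hf1 => by
      rw [h1, h2, div_one, div_one]
      exact meanFunctional_sub_le_of_tvDist_le ENNReal.toReal_nonneg hle hf hf1
  have key := h.comp_semigroup (isPositive_meanFunctional μ) (isPositive_meanFunctional ν)
    (h1 ▸ one_pos) (h2 ▸ one_pos) hA ht hl hb hB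
  rw [← ENNReal.ofReal_toReal hfin, ← ENNReal.ofReal_mul (Real.exp_pos _).le]
  refine tvDist_le_of_forall fun f hf0 hf hf1 => ?_
  rw [meanFunctional_apply, meanFunctional_apply, integral_condLaw hA μ ht hf0,
    integral_condLaw hA ν ht hf0]
  exact key f hf0 hf hf1

end ConditionedLaw

/-! ### Quasi-stationary distributions -/

section QuasiStationary
variable {S : Type*} [Countable S] [MeasurableSpace S] [DiscreteMeasurableSpace S]
  {Q : S → S → ℝ≥0} {p : S → ℝ≥0}

/-- If the conditioned evolution contracts the total variation distance exponentially, then it has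
a fixed law: the laws at integer times form a Cauchy sequence in the dual of `BddFun S`, and the
limit functional is again positive and normal. -/
theorem exists_isQSD_of_contraction [Nonempty S] (hA : BoundedRates Q p) {r : ℝ} (hr : 0 < r)
    (hc : ∀ μ ν : Measure S, IsProbabilityMeasure μ → IsProbabilityMeasure ν → ∀ t : ℝ, 0 ≤ t →
      tvDist (condLaw hA μ t) (condLaw hA ν t)
        ≤ ENNReal.ofReal (Real.exp (-(r * t))) * tvDist μ ν) :
    ∃ ν : Measure S, IsQSD hA ν := by
  let μ₀ : Measure S := Measure.dirac (Classical.arbitrary S)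
  have hprob : ∀ t : ℝ, 0 ≤ t → IsProbabilityMeasure (condLaw hA μ₀ t) := fun t ht =>
    isProbabilityMeasure_condLaw hA μ₀ ht
  have hprobN : ∀ n : ℕ, IsProbabilityMeasure (condLaw hA μ₀ n) := fun n =>
    hprob n n.cast_nonneg
  have hclose : ∀ (N : ℕ) (s t : ℝ), (N : ℝ) ≤ s → (N : ℝ) ≤ t →
      tvDist (condLaw hA μ₀ s) (condLaw hA μ₀ t) ≤ ENNReal.ofReal (Real.exp (-(r * N))) := by
    intro N s t hs ht
    have := hprob (s - N) (sub_nonneg.2 hs)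
    have := hprob (t - N) (sub_nonneg.2 ht)
    have h := hc _ _ (hprob _ (sub_nonneg.2 hs)) (hprob _ (sub_nonneg.2 ht)) N N.cast_nonneg
    rw [condLaw_condLaw hA μ₀ (sub_nonneg.2 hs) N,
      condLaw_condLaw hA μ₀ (sub_nonneg.2 ht) N, sub_add_cancel, sub_add_cancel] at h
    exact h.trans (mul_le_of_le_one_right' (tvDist_le_one _ _))
  have hdecay : Tendsto (fun n : ℕ => 2 * Real.exp (-(r * n))) atTop (𝓝 0) := by
    have := (Real.tendsto_exp_neg_atTop_nhds_zero.comp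
      (tendsto_natCast_atTop_atTop.const_mul_atTop hr)).const_mul 2
    simpa using this
  let m : ℕ → BddFun S →L[ℝ] ℝ := fun n => meanFunctional (condLaw hA μ₀ n)
  have hcauchy : CauchySeq m := by
    refine cauchySeq_of_le_tendsto_0 _ (fun n k N hn hk => ?_) hdecay
    rw [dist_eq_norm]
    refine ContinuousLinearMap.opNorm_le_bound _ (by positivity) fun f => ?_
    exact abs_meanFunctional_sub_le (Real.exp_pos _).le
      (hclose N n k (Nat.cast_le.2 hn) (Nat.cast_le.2 hk)) f
  obtain ⟨φ, hφ⟩ := cauchySeq_tendsto_of_complete hcauchy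
  have happ : ∀ f, Tendsto (fun n => m n f) atTop (𝓝 (φ f)) := fun f =>
    ((ContinuousLinearMap.apply ℝ ℝ f).continuous.tendsto _).comp hφ
  have hpos : IsPositive φ := fun f hf0 hf =>
    ge_of_tendsto' (happ f) fun n => isPositive_meanFunctional _ f hf0 hf
  have hnormal : IsNormal φ := .of_tendsto (fun n => isNormal_meanFunctional _) hφ
  have hone : φ (alive S) = 1 := tendsto_nhds_unique (happ _)
    (tendsto_const_nhds.congr fun n => (meanFunctional_alive (condLaw hA μ₀ n)).symm)
  have hφ1 : 0 < φ (alive S) := hone ▸ one_pos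
  have hν := isProbabilityMeasure_stateMeasure hpos hnormal hφ1
  -- Both `m n` and the conditioned image of `m n` at time `t` converge to `φ`.
  have hfix : ∀ t : ℝ, 0 ≤ t → ∀ f : BddFun S, f none = 0 →
      φ (semigroup hA t f) / φ (semigroup hA t (alive S)) = φ f := by
    intro t ht f hf
    have lim := (happ (semigroup hA t f)).div (happ (semigroup hA t (alive S)))
      (hpos.semigroup_alive_pos hφ1 hA ht).ne'
    refine tendsto_nhds_unique lim ?_
    have hdiff : Tendsto (fun n : ℕ =>
        m n (semigroup hA t f) / m n (semigroup hA t (alive S)) - m n f) atTop (𝓝 0) := by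
      refine squeeze_zero_norm (fun n => ?_) (by simpa using hdecay.mul_const ‖f‖)
      have hn : (n : ℝ) ≤ n + t := by linarith
      have := hprob (n + t) (by positivity)
      have e : m n (semigroup hA t f) / m n (semigroup hA t (alive S)) =
          meanFunctional (condLaw hA μ₀ (n + t)) f := by
        have h := integral_condLaw hA (condLaw hA μ₀ n) ht hf
        rw [condLaw_condLaw hA μ₀ n.cast_nonneg t] at h
        exact h.symm
      rw [e]
      exact abs_meanFunctional_sub_le (Real.exp_pos _).le (hclose n _ _ hn le_rfl) f
    have h := hdiff.add (happ f)
    simp only [sub_add_cancel, zero_add] at h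
    exact h
  refine ⟨stateMeasure φ, hν, fun t ht => ?_⟩
  have hmean : ∀ f : BddFun S, f none = 0 → meanAt hA (stateMeasure φ) t f =
      φ (semigroup hA t f) := fun f hf => by
    rw [meanAt, integral_stateMeasure hpos hnormal hφ1 ((semigroup_none hA t f).trans hf), hone,
      div_one]
  rw [condLaw]
  conv_rhs => rw [stateMeasure]
  congr 1
  funext k
  rw [hmean _ (ind_singleton_none k), hmean _ alive_none, hfix t ht _ (ind_singleton_none k), hone,
    div_one]

theorem IsQSD.eq_of_contraction (hA : BoundedRates Q p) {r : ℝ} (hr : 0 < r)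
    (hc : ∀ μ ν : Measure S, IsProbabilityMeasure μ → IsProbabilityMeasure ν → ∀ t : ℝ, 0 ≤ t →
      tvDist (condLaw hA μ t) (condLaw hA ν t)
        ≤ ENNReal.ofReal (Real.exp (-(r * t))) * tvDist μ ν)
    {μ ν : Measure S} (hμ : IsQSD hA μ) (hν : IsQSD hA ν) : μ = ν := by
  have := hμ.1
  have := hν.1
  have h := hc μ ν hμ.1 hν.1 1 zero_le_one
  rw [hμ.2 1 zero_le_one, hν.2 1 zero_le_one, mul_one] at h
  refine eq_of_tvDist_eq_zero ?_
  by_contra h0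
  have hfin : tvDist μ ν ≠ ∞ := ((tvDist_le_one μ ν).trans_lt ENNReal.one_lt_top).ne
  have hlt : ENNReal.ofReal (Real.exp (-r)) < 1 := by
    rw [ENNReal.ofReal_lt_one, Real.exp_lt_one_iff]; linarith
  have := ENNReal.mul_lt_mul_left h0 hfin hlt
  rw [one_mul] at this
  exact absurd h this.not_ge

end QuasiStationary

end KilledChain

open KilledChain in
theorem mainTheorem5 {S : Type*} [Countable S] [Nonempty S] [MeasurableSpace S]
    [DiscreteMeasurableSpace S] (Q : S → S → ℝ≥0) (p : S → ℝ≥0)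
    (hA : KilledChain.BoundedRates Q p) (hρ : 0 < KilledChain.rho Q p) :
    (∀ μ : Measure S, IsProbabilityMeasure μ → ∀ t : ℝ, 0 ≤ t →
      IsProbabilityMeasure (KilledChain.condLaw hA μ t)) ∧
    (∀ μ ν : Measure S, IsProbabilityMeasure μ → IsProbabilityMeasure ν → ∀ t : ℝ, 0 ≤ t →
      KilledChain.tvDist (KilledChain.condLaw hA μ t) (KilledChain.condLaw hA ν t)
        ≤ EReal.exp (-(KilledChain.rho Q p * (t : EReal))) * KilledChain.tvDist μ ν) ∧
    ∃ νqs : Measure S, KilledChain.IsQSD hA νqs ∧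
      (∀ ν : Measure S, KilledChain.IsQSD hA ν → ν = νqs) ∧
      ∀ μ : Measure S, IsProbabilityMeasure μ → ∀ t : ℝ, 0 ≤ t →
        KilledChain.tvDist (KilledChain.condLaw hA μ t) νqs
          ≤ EReal.exp (-(KilledChain.rho Q p * (t : EReal))) := by
  have hprob : ∀ μ : Measure S, IsProbabilityMeasure μ → ∀ t : ℝ, 0 ≤ t →
      IsProbabilityMeasure (condLaw hA μ t) := fun μ _ t ht => isProbabilityMeasure_condLaw hA μ ht
  have hcontr : (∀ μ ν : Measure S, IsProbabilityMeasure μ → IsProbabilityMeasure ν →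
      ∀ t : ℝ, 0 ≤ t → tvDist (condLaw hA μ t) (condLaw hA ν t)
        ≤ EReal.exp (-(rho Q p * (t : EReal))) * tvDist μ ν) ∧
      ∃ r : ℝ, 0 < r ∧ ∀ μ ν : Measure S, IsProbabilityMeasure μ → IsProbabilityMeasure ν →
        ∀ t : ℝ, 0 ≤ t → tvDist (condLaw hA μ t) (condLaw hA ν t)
          ≤ ENNReal.ofReal (Real.exp (-(r * t))) * tvDist μ ν := by
    rcases subsingleton_or_nontrivial S with hS | hS
    · -- On a one-point space all probability measures coincide.
      have hzero : ∀ μ ν : Measure S, IsProbabilityMeasure μ → IsProbabilityMeasure ν →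
          ∀ t : ℝ, 0 ≤ t → tvDist (condLaw hA μ t) (condLaw hA ν t) = 0 := by
        intro μ ν hμ hν t _
        have : μ = ν := Measure.ext_of_singleton fun a => by
          rw [(Set.eq_univ_of_forall fun b => Subsingleton.elim b a : ({a} : Set S) = Set.univ),
            measure_univ, measure_univ]
        rw [this, tvDist_self]
      exact ⟨fun μ ν hμ hν t ht => (hzero μ ν hμ hν t ht).trans_le zero_le,
        1, one_pos, fun μ ν hμ hν t ht => (hzero μ ν hμ hν t ht).trans_le zero_le⟩
    · have hle : ∀ i, (⨅ i, (p i : ℝ≥0∞)).toReal ≤ p i := fun i =>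
        ENNReal.toReal_mono ENNReal.coe_ne_top (iInf_le (fun i => (p i : ℝ≥0∞)) i)
      have hmain := fun (μ ν : Measure S) (_ : IsProbabilityMeasure μ)
        (_ : IsProbabilityMeasure ν) (t : ℝ) (ht : 0 ≤ t) =>
        tvDist_condLaw_le hA μ ν ht ENNReal.ofReal_toReal_le hle hA.killing_le
      rw [rho_eq_coe hA] at hρ ⊢
      refine ⟨fun μ ν hμ hν t ht => ?_, _, EReal.coe_pos.1 hρ, hmain⟩
      rw [← EReal.coe_mul, ← EReal.coe_neg, EReal.exp_coe]
      exact hmain μ ν hμ hν t ht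
  obtain ⟨hexp, r, hr, hc⟩ := hcontr
  obtain ⟨νqs, hν⟩ := exists_isQSD_of_contraction hA hr hc
  refine ⟨hprob, hexp, νqs, hν, fun ν h => h.eq_of_contraction hA hr hc hν, fun μ hμ t ht => ?_⟩
  have := hν.1
  have h := hexp μ νqs hμ hν.1 t ht
  rw [hν.2 t ht] at h
  exact h.trans (mul_le_of_le_one_right' (tvDist_le_one _ _))
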